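/- Let $X$ be the graph with vertex set $\mathbb{Z}^2$ in which two vertices are joined by an edge if and only if their $\ell^1$-distance is one. The vertex boundary $\partial A$ of a set $A\subset\mathbb{Z}^2$ is the set of vertices not in $A$ that are adjacent to a vertex of $A$. A set $A$ is minimal if $|\partial A|\le|\partial B|$ for every $B\subset\mathbb{Z}^2$ with $|B|=|A|$. Two sets are congruent if some graph automorphism of $X$ maps one onto the other. A set $A$ is uniquely minimal if it is minimal and every minimal set with the same number of vertices as $A$ is congruent to $A$. For $\alpha,\beta\in\mathbb{N}=\{0,1,2,\dots\}$ let $B(\alpha,\beta)$ be the set of all $(x,y)\in\mathbb{Z}^2$ with $0\le y-x\le\alpha$ and $0\le y+x\le\beta$. Theorem. A finite non-empty subset of $\mathbb{Z}^2$ is uniquely minimal if and only if it is congruent to $B(2n,2n)$ or to $B(n,n+1)$ for some $n\in\mathbb{N}$. -/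

import Mathlib

/-- The graph with vertex set `ℤ × ℤ` in which two vertices are adjacent exactly when their
`ℓ¹`-distance is one. -/
def latticeGraph : SimpleGraph (ℤ × ℤ) where
  Adj p q := |p.1 - q.1| + |p.2 - q.2| = 1
  symm := ⟨fun p q h => by rw [abs_sub_comm q.1 p.1, abs_sub_comm q.2 p.2]; exact h⟩
  loopless := ⟨fun p h => by simp at h⟩

/-- The vertex boundary of a set of vertices: the vertices outside the set that are adjacent to
a vertex of the set. -/
def vertexBoundary {V : Type*} (G : SimpleGraph V) (A : Set V) : Set V :=
  {u | u ∉ A ∧ ∃ v ∈ A, G.Adj u v}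

/-- A set of vertices is minimal if its vertex boundary is smallest among those of all sets with
the same number of vertices. -/
def IsMinimalSet {V : Type*} (G : SimpleGraph V) (A : Set V) : Prop :=
  ∀ B : Set V, B.encard = A.encard → (vertexBoundary G A).encard ≤ (vertexBoundary G B).encard

/-- Two sets of vertices are congruent if a graph automorphism maps the first onto the second. -/
def CongruentSets {V : Type*} (G : SimpleGraph V) (A B : Set V) : Prop :=
  ∃ φ : G ≃g G, φ '' A = B

/-- A set is uniquely minimal if it is minimal and every minimal set with the same number of
vertices is congruent to it. -/
def IsUniquelyMinimal {V : Type*} (G : SimpleGraph V) (A : Set V) : Prop :=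
  IsMinimalSet G A ∧
    ∀ B : Set V, IsMinimalSet G B → B.encard = A.encard → CongruentSets G B A

/-- The box `B(α, β)`: the vertices `(x, y)` with `0 ≤ y - x ≤ α` and `0 ≤ y + x ≤ β`. -/
def latticeBox (α β : ℕ) : Set (ℤ × ℤ) :=
  {p | 0 ≤ p.2 - p.1 ∧ p.2 - p.1 ≤ (α : ℤ) ∧ 0 ≤ p.2 + p.1 ∧ p.2 + p.1 ≤ (β : ℤ)}

/-! The lattice is bipartite. In the coordinates `(y - x, y + x)` the even vertices are the points
`(2i, 2j)` and the odd ones the points `(2i + 1, 2j + 1)`, so each parity class is a copy of the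
plane. Let a finite set have even part `S` and odd part `T`. Its boundary consists of `(T + {0,1}²)
\ S` and `(S - {0,1}²) \ T`.

Let `p, q` and `p', q'` be the sizes of the projections of `S` and `T`. A non-empty `S` satisfies
`|S + {0,1}²| ≥ |S| + p + q + 1` (`card_le_card_thicken`), so if both parts are non-empty, the
boundary size `t` is at least `X + Y + 2` with `X = p + q`, `Y = p' + q'`. Since `8pq ≤ 2X²` and
`8p'q' ≤ 2Y²`, the set has size `a` with `8a ≤ (X + Y)² + (X - Y)²`. The boundary inside a single
class rules out `|X - Y| ≥ 3` near equality, whence `8a ≤ (t - 2)² + 4` (`eight_mul_card_le`).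

For `a ≥ 2`, the values `8a = (t - 2)² + 4` and `8a = (t - 2)² - 1` leave so little slack that `S`
and `T` are interlaced rectangles (`eq_shiftedBox_of_extremal`). The set is then a box with equal
sides, respectively with sides differing by one, and is determined up to congruence.

For any other size, let `s` be least with `8a ≤ (s + 2)² + 4`. Two boxes with side sum `s` and
different longer sides both have room for `a` points. Deleting points from one side of each does not
raise the boundary above `s + 4`, so both remain minimal, and their diameters differ
(`not_isUniquelyMinimal_of_truncatedBox`). -/

/-! ### Sumsets with a unit square -/

/-- The union of a finite set of the plane with its translate by `(1, 0)`. -/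
def thickenFst (S : Finset (ℤ × ℤ)) : Finset (ℤ × ℤ) := S ∪ S.image fun p => (p.1 + 1, p.2)

/-- The union of a finite set of the plane with its translate by `(0, 1)`. -/
def thickenSnd (S : Finset (ℤ × ℤ)) : Finset (ℤ × ℤ) := S ∪ S.image fun p => (p.1, p.2 + 1)

/-- The sumset of a finite set of the plane with `{0, 1} × {0, 1}`. -/
def thicken (S : Finset (ℤ × ℤ)) : Finset (ℤ × ℤ) := thickenFst (thickenSnd S)

/-- The union of a finite set of integers with its translate by `1`. -/
def thickenInt (I : Finset ℤ) : Finset ℤ := I ∪ I.image (· + 1)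

theorem mem_thickenFst {S : Finset (ℤ × ℤ)} {i j : ℤ} :
    (i, j) ∈ thickenFst S ↔ (i, j) ∈ S ∨ (i - 1, j) ∈ S := by
  simp only [thickenFst, Finset.mem_union, Finset.mem_image, Prod.mk.injEq, Prod.exists]
  refine or_congr Iff.rfl ⟨?_, fun h => ⟨_, _, h, by ring, rfl⟩⟩
  rintro ⟨a, b, h, rfl, rfl⟩
  simpa using h

theorem mem_thickenSnd {S : Finset (ℤ × ℤ)} {i j : ℤ} :
    (i, j) ∈ thickenSnd S ↔ (i, j) ∈ S ∨ (i, j - 1) ∈ S := by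
  simp only [thickenSnd, Finset.mem_union, Finset.mem_image, Prod.mk.injEq, Prod.exists]
  refine or_congr Iff.rfl ⟨?_, fun h => ⟨_, _, h, rfl, by ring⟩⟩
  rintro ⟨a, b, h, rfl, rfl⟩
  simpa using h

theorem mem_thicken {S : Finset (ℤ × ℤ)} {i j : ℤ} :
    (i, j) ∈ thicken S ↔
      ((i, j) ∈ S ∨ (i, j - 1) ∈ S) ∨ (i - 1, j) ∈ S ∨ (i - 1, j - 1) ∈ S := by
  rw [thicken, mem_thickenFst, mem_thickenSnd, mem_thickenSnd]

theorem mem_thickenInt {I : Finset ℤ} {i : ℤ} : i ∈ thickenInt I ↔ i ∈ I ∨ i - 1 ∈ I := by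
  simp only [thickenInt, Finset.mem_union, Finset.mem_image]
  refine or_congr Iff.rfl ⟨?_, fun h => ⟨_, h, by ring⟩⟩
  rintro ⟨a, h, rfl⟩
  simpa using h

/-- Every non-empty row gains at least the point just after its last one. -/
theorem card_add_card_snd_le_thickenFst (S : Finset (ℤ × ℤ)) :
    S.card + (S.image Prod.snd).card ≤ (thickenFst S).card := by
  have key : ∀ j ∈ S.image Prod.snd, ∃ i, (i, j) ∈ S ∧ (i + 1, j) ∉ S := by
    intro j hj
    obtain ⟨⟨i, j'⟩, hp, rfl⟩ := Finset.mem_image.1 hj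
    obtain ⟨p, hp, hmax⟩ := (S.filter fun p => p.2 = j').exists_max_image Prod.fst
      ⟨(i, j'), by simpa using hp⟩
    obtain ⟨hpS, hpj⟩ := Finset.mem_filter.1 hp
    refine ⟨p.1, by subst hpj; exact hpS, fun h => ?_⟩
    have := hmax (p.1 + 1, j') (by simpa using h)
    simp at this
  choose! f hf using key
  have hsub : S ∪ (S.image Prod.snd).image (fun j => (f j + 1, j)) ⊆ thickenFst S := by
    intro p hp
    rcases Finset.mem_union.1 hp with h | h
    · exact Finset.mem_union_left _ h
    · obtain ⟨j, hj, rfl⟩ := Finset.mem_image.1 h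
      exact mem_thickenFst.2 (Or.inr (by simpa using (hf j hj).1))
  have hdisj : Disjoint S ((S.image Prod.snd).image fun j => (f j + 1, j)) := by
    rw [Finset.disjoint_left]
    intro p hp h
    obtain ⟨j, hj, rfl⟩ := Finset.mem_image.1 h
    exact (hf j hj).2 hp
  calc S.card + (S.image Prod.snd).card
      = S.card + ((S.image Prod.snd).image fun j => (f j + 1, j)).card := by
        rw [Finset.card_image_of_injective (S.image Prod.snd)
          (f := fun j => (f j + 1, j)) fun a b h => (Prod.mk.inj h).2]
    _ = _ := (Finset.card_union_of_disjoint hdisj).symm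
    _ ≤ _ := Finset.card_le_card hsub

theorem card_image_swap (S : Finset (ℤ × ℤ)) : (S.image Prod.swap).card = S.card :=
  Finset.card_image_of_injective _ Prod.swap_injective

theorem thickenSnd_image_swap (S : Finset (ℤ × ℤ)) :
    (thickenSnd S).image Prod.swap = thickenFst (S.image Prod.swap) := by
  simp only [thickenSnd, thickenFst, Finset.image_union, Finset.image_image]
  rfl

theorem card_add_card_fst_le_thickenSnd (S : Finset (ℤ × ℤ)) :
    S.card + (S.image Prod.fst).card ≤ (thickenSnd S).card := by
  have h := card_add_card_snd_le_thickenFst (S.image Prod.swap)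
  rw [← thickenSnd_image_swap, card_image_swap, card_image_swap, Finset.image_image] at h
  exact h

theorem image_snd_thickenSnd (S : Finset (ℤ × ℤ)) :
    (thickenSnd S).image Prod.snd = thickenInt (S.image Prod.snd) := by
  simp only [thickenSnd, thickenInt, Finset.image_union, Finset.image_image]
  rfl

theorem card_add_one_le_thickenInt {I : Finset ℤ} (hI : I.Nonempty) :
    I.card + 1 ≤ (thickenInt I).card := by
  have hM : I.max' hI + 1 ∉ I := fun h => by
    have := I.le_max' _ h
    omega
  rw [← Finset.card_insert_of_notMem hM]
  refine Finset.card_le_card (Finset.insert_subset ?_ fun i h => mem_thickenInt.2 (Or.inl h))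
  exact mem_thickenInt.2 (Or.inr (by simpa using I.max'_mem hI))

/-- Thickening vertically gains a point per column and at least one new row; thickening the result
horizontally then gains a point per row. The new row accounts for the final `+ 1`. -/
theorem card_le_card_thicken {S : Finset (ℤ × ℤ)} (hS : S.Nonempty) :
    S.card + (S.image Prod.fst).card + (S.image Prod.snd).card + 1 ≤ (thicken S).card := by
  have h1 := card_add_card_fst_le_thickenSnd S
  have h2 := card_add_card_snd_le_thickenFst (thickenSnd S)
  have h3 := card_add_one_le_thickenInt (hS.image Prod.snd)
  rw [image_snd_thickenSnd] at h2
  change _ ≤ (thickenFst _).card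
  omega

theorem card_le_card_fst_mul_card_snd (S : Finset (ℤ × ℤ)) :
    S.card ≤ (S.image Prod.fst).card * (S.image Prod.snd).card := by
  rw [← Finset.card_product]
  exact Finset.card_le_card Finset.subset_product

/-- The successor of the maximum is always new; a gap would contribute a second new element. -/
theorem eq_Icc_of_card_thickenInt_le {I : Finset ℤ} (hI : I.Nonempty)
    (h : (thickenInt I).card ≤ I.card + 1) :
    ∃ i : ℤ, ∀ k, k ∈ I ↔ i ≤ k ∧ k < i + I.card := by
  set M := I.max' hI with hMdef
  set m := I.min' hI with hmdef
  have hM : M + 1 ∉ I := fun h => by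
    have := I.le_max' _ h
    omega
  have hstep : ∀ c ∈ I, c ≠ M → c + 1 ∈ I := by
    intro c hc hcM
    by_contra hc1
    have hsub : insert (c + 1) (insert (M + 1) I) ⊆ thickenInt I := by
      refine Finset.insert_subset ?_ (Finset.insert_subset ?_ fun i h =>
        mem_thickenInt.2 (Or.inl h))
      · exact mem_thickenInt.2 (Or.inr (by simpa using hc))
      · exact mem_thickenInt.2 (Or.inr (by simpa using I.max'_mem hI))
    have hcard := Finset.card_le_card hsub
    rw [Finset.card_insert_of_notMem, Finset.card_insert_of_notMem hM] at hcard
    · omega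
    · simp [hc1, hcM]
  have hall : ∀ n : ℕ, m + n ≤ M → m + n ∈ I := by
    intro n
    induction n with
    | zero => intro _; simpa using I.min'_mem hI
    | succ n ih =>
      intro hn
      push_cast at hn ⊢
      rw [← add_assoc]
      exact hstep _ (ih (by omega)) (by omega)
  have hIcc : I = Finset.Icc m M := by
    ext k
    rw [Finset.mem_Icc]
    refine ⟨fun hk => ⟨I.min'_le k hk, I.le_max' k hk⟩, fun hk => ?_⟩
    have := hall (k - m).toNat (by omega)
    rwa [show m + ((k - m).toNat : ℤ) = k by omega] at this
  have hmM : m ≤ M := I.min'_le_max' hI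
  have hcard : (I.card : ℤ) = M + 1 - m := by
    rw [hIcc, Int.card_Icc]
    omega
  refine ⟨m, fun k => ?_⟩
  rw [hcard]
  conv_lhs => rw [hIcc]
  rw [Finset.mem_Icc]
  omega

theorem thicken_product (I J : Finset ℤ) : thicken (I ×ˢ J) = thickenInt I ×ˢ thickenInt J := by
  ext ⟨i, j⟩
  simp only [mem_thicken, Finset.mem_product, mem_thickenInt]
  tauto

/-- A finite set of the plane with as many points as its projections allow, and with the smallest
possible sumset with a unit square, is a rectangle. -/
theorem eq_rectangle_of_card_thicken_le {S : Finset (ℤ × ℤ)} (hS : S.Nonempty)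
    (h1 : (S.image Prod.fst).card * (S.image Prod.snd).card ≤ S.card)
    (h2 : (thicken S).card ≤ S.card + (S.image Prod.fst).card + (S.image Prod.snd).card + 1) :
    ∃ i j : ℤ, ∀ k l, (k, l) ∈ S ↔ (i ≤ k ∧ k < i + (S.image Prod.fst).card) ∧
      (j ≤ l ∧ l < j + (S.image Prod.snd).card) := by
  have hprod : S = S.image Prod.fst ×ˢ S.image Prod.snd :=
    Finset.eq_of_subset_of_card_le Finset.subset_product (by rwa [Finset.card_product])
  have hI := hS.image Prod.fst
  have hJ := hS.image Prod.snd
  have h3 := card_add_one_le_thickenInt hI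
  have h4 := card_add_one_le_thickenInt hJ
  have hc := card_le_card_fst_mul_card_snd S
  have ht : (thicken S).card =
      (thickenInt (S.image Prod.fst)).card * (thickenInt (S.image Prod.snd)).card := by
    conv_lhs => rw [hprod]
    rw [thicken_product, Finset.card_product]
  have hp := hI.card_pos
  have hq := hJ.card_pos
  -- The bound `h2` equals `(p + 1)(q + 1)` for a full product, so neither thickened projection can
  -- gain more than one element.
  obtain ⟨i, hi⟩ := eq_Icc_of_card_thickenInt_le hI (by nlinarith)
  obtain ⟨j, hj⟩ := eq_Icc_of_card_thickenInt_le hJ (by nlinarith)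
  refine ⟨i, j, fun k l => ?_⟩
  conv_lhs => rw [hprod]
  rw [Finset.mem_product]
  exact and_congr (hi k) (hj l)

/-! ### The two parity classes of the lattice -/

/-- The parametrization of the vertices with even coordinate sum by the plane. -/
def evenVertex (p : ℤ × ℤ) : ℤ × ℤ := (p.2 - p.1, p.1 + p.2)

/-- The parametrization of the vertices with odd coordinate sum by the plane. -/
def oddVertex (p : ℤ × ℤ) : ℤ × ℤ := (p.2 - p.1, p.1 + p.2 + 1)

theorem evenVertex_injective : Function.Injective evenVertex := by
  rintro ⟨a, b⟩ ⟨c, d⟩ h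
  simp only [evenVertex, Prod.mk.injEq] at h ⊢
  omega

theorem oddVertex_injective : Function.Injective oddVertex := by
  rintro ⟨a, b⟩ ⟨c, d⟩ h
  simp only [oddVertex, Prod.mk.injEq] at h ⊢
  omega

theorem evenVertex_ne_oddVertex (p q : ℤ × ℤ) : evenVertex p ≠ oddVertex q := by
  obtain ⟨a, b⟩ := p
  obtain ⟨c, d⟩ := q
  simp only [evenVertex, oddVertex, ne_eq, Prod.mk.injEq]
  omega

theorem exists_eq_evenVertex_or_oddVertex (p : ℤ × ℤ) :
    (∃ q, p = evenVertex q) ∨ ∃ q, p = oddVertex q := by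
  obtain ⟨x, y⟩ := p
  rcases Int.emod_two_eq_zero_or_one (x + y) with h | h
  · refine Or.inl ⟨((y - x) / 2, (x + y) / 2), ?_⟩
    simp only [evenVertex, Prod.mk.injEq]
    omega
  · refine Or.inr ⟨((y - x - 1) / 2, (x + y - 1) / 2), ?_⟩
    simp only [oddVertex, Prod.mk.injEq]
    omega

theorem encard_eq_card_add_card {A : Set (ℤ × ℤ)} {S T : Finset (ℤ × ℤ)}
    (hS : ∀ p, p ∈ S ↔ evenVertex p ∈ A) (hT : ∀ p, p ∈ T ↔ oddVertex p ∈ A) :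
    A.encard = ((S.card + T.card : ℕ) : ℕ∞) := by
  have hA : A = evenVertex '' S ∪ oddVertex '' T := by
    ext p
    simp only [Set.mem_union, Set.mem_image, Finset.mem_coe, hS, hT]
    constructor
    · intro hp
      rcases exists_eq_evenVertex_or_oddVertex p with ⟨q, rfl⟩ | ⟨q, rfl⟩
      · exact Or.inl ⟨q, hp, rfl⟩
      · exact Or.inr ⟨q, hp, rfl⟩
    · rintro (⟨q, hq, rfl⟩ | ⟨q, hq, rfl⟩) <;> exact hq
  rw [hA, Set.encard_union_eq, evenVertex_injective.encard_image, oddVertex_injective.encard_image,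
    Set.encard_coe_eq_coe_finsetCard, Set.encard_coe_eq_coe_finsetCard, Nat.cast_add]
  rw [Set.disjoint_left]
  rintro _ ⟨p, _, rfl⟩ ⟨q, _, h⟩
  exact evenVertex_ne_oddVertex p q h.symm

theorem latticeGraph_adj_iff {x y x' y' : ℤ} : latticeGraph.Adj (x, y) (x', y') ↔
    (x' = x ∧ (y' = y + 1 ∨ y' = y - 1)) ∨ (y' = y ∧ (x' = x + 1 ∨ x' = x - 1)) := by
  change |x - x'| + |y - y'| = 1 ↔ _
  rcases abs_cases (x - x') with ⟨h1, h2⟩ | ⟨h1, h2⟩ <;>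
  rcases abs_cases (y - y') with ⟨h3, h4⟩ | ⟨h3, h4⟩ <;> omega

/-- The translate of `thicken S` by `(-1, -1)`. -/
def thickenNeg (S : Finset (ℤ × ℤ)) : Finset (ℤ × ℤ) :=
  (thicken S).image fun p => (p.1 - 1, p.2 - 1)

theorem card_thickenNeg (S : Finset (ℤ × ℤ)) : (thickenNeg S).card = (thicken S).card :=
  Finset.card_image_of_injective _ fun p q h => by
    simp only [Prod.mk.injEq] at h
    exact Prod.ext (by omega) (by omega)

theorem mem_thickenNeg {S : Finset (ℤ × ℤ)} {i j : ℤ} :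
    (i, j) ∈ thickenNeg S ↔
      ((i + 1, j + 1) ∈ S ∨ (i + 1, j) ∈ S) ∨ (i, j + 1) ∈ S ∨ (i, j) ∈ S := by
  have h : (i, j) ∈ thickenNeg S ↔ (i + 1, j + 1) ∈ thicken S := by
    simp only [thickenNeg, Finset.mem_image, Prod.mk.injEq, Prod.exists]
    refine ⟨?_, fun h => ⟨_, _, h, by ring, by ring⟩⟩
    rintro ⟨a, b, h, rfl, rfl⟩
    simpa using h
  rw [h, mem_thicken]
  simp

theorem evenVertex_mem_vertexBoundary {A : Set (ℤ × ℤ)} {S T : Finset (ℤ × ℤ)}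
    (hS : ∀ p, p ∈ S ↔ evenVertex p ∈ A) (hT : ∀ p, p ∈ T ↔ oddVertex p ∈ A) (p : ℤ × ℤ) :
    p ∈ thicken T \ S ↔ evenVertex p ∈ vertexBoundary latticeGraph A := by
  obtain ⟨i, j⟩ := p
  rw [Finset.mem_sdiff, mem_thicken, hS, hT, hT, hT, hT, and_comm]
  refine and_congr Iff.rfl ⟨?_, ?_⟩
  · rintro ((h | h) | (h | h)) <;>
    refine ⟨_, h, ?_⟩ <;> (dsimp only [evenVertex, oddVertex]; rw [latticeGraph_adj_iff]; omega)
  · rintro ⟨⟨x, y⟩, hv, hadj⟩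
    simp only [evenVertex, latticeGraph_adj_iff] at hadj
    simp only [oddVertex]
    rcases hadj with ⟨hx, hy | hy⟩ | ⟨hy, hx | hx⟩ <;> subst hx hy
    · exact Or.inl (Or.inl hv)
    · refine Or.inr (Or.inr ?_); convert hv using 2 <;> ring
    · refine Or.inr (Or.inl ?_); convert hv using 2 <;> ring
    · refine Or.inl (Or.inr ?_); convert hv using 2 <;> ring

theorem oddVertex_mem_vertexBoundary {A : Set (ℤ × ℤ)} {S T : Finset (ℤ × ℤ)}
    (hS : ∀ p, p ∈ S ↔ evenVertex p ∈ A) (hT : ∀ p, p ∈ T ↔ oddVertex p ∈ A) (p : ℤ × ℤ) :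
    p ∈ thickenNeg S \ T ↔ oddVertex p ∈ vertexBoundary latticeGraph A := by
  obtain ⟨i, j⟩ := p
  rw [Finset.mem_sdiff, mem_thickenNeg, hT, hS, hS, hS, hS, and_comm]
  refine and_congr Iff.rfl ⟨?_, ?_⟩
  · rintro ((h | h) | (h | h)) <;>
    refine ⟨_, h, ?_⟩ <;> (dsimp only [evenVertex, oddVertex]; rw [latticeGraph_adj_iff]; omega)
  · rintro ⟨⟨x, y⟩, hv, hadj⟩
    simp only [oddVertex, latticeGraph_adj_iff] at hadj
    simp only [evenVertex]
    rcases hadj with ⟨hx, hy | hy⟩ | ⟨hy, hx | hx⟩ <;> subst hx hy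
    · refine Or.inl (Or.inl ?_); convert hv using 2 <;> ring
    · refine Or.inr (Or.inr ?_); convert hv using 2 ; ring
    · refine Or.inr (Or.inl ?_); convert hv using 2 <;> ring
    · refine Or.inl (Or.inr ?_); convert hv using 2 <;> ring

theorem exists_parity_finsets {A : Set (ℤ × ℤ)} (hA : A.Finite) :
    ∃ S T : Finset (ℤ × ℤ),
      (∀ p, p ∈ S ↔ evenVertex p ∈ A) ∧ ∀ p, p ∈ T ↔ oddVertex p ∈ A :=
  ⟨(hA.preimage evenVertex_injective.injOn).toFinset,
    (hA.preimage oddVertex_injective.injOn).toFinset, by simp, by simp⟩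

/-! ### The isoperimetric inequality -/

/-- With `X = p + q` and `Y = p' + q'`, write `8(a + b) = 8(a - b) + 16b`. The hypothesis `h2`,
which counts only the boundary in the class of the smaller projections, controls `a - b`, and `4b ≤
Y²`. Only `b` needs a bound by its projections. -/
theorem eight_mul_add_lt {p q p' q' a b t : ℤ} (hp' : 1 ≤ p')
    (hq' : 1 ≤ q') (hb : b ≤ p' * q') (h1 : p + q + p' + q' + 2 ≤ t)
    (h2 : p + q + 1 + a - b ≤ t) (hle : p' + q' + 3 ≤ p + q) :
    8 * (a + b) < (t - 2) ^ 2 - 1 := by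
  have hb' : 4 * b ≤ (p' + q') ^ 2 := by nlinarith [sq_nonneg (p' - q')]
  obtain ⟨X, hX⟩ : ∃ X, X = p + q := ⟨_, rfl⟩
  obtain ⟨Y, hY⟩ : ∃ Y, Y = p' + q' := ⟨_, rfl⟩
  obtain ⟨d, hd⟩ : ∃ d, X = Y + 3 + d := ⟨X - Y - 3, by ring⟩
  obtain ⟨e, he⟩ : ∃ e, t = X + Y + 2 + e := ⟨t - X - Y - 2, by ring⟩
  rw [← hY] at hb'
  have hY2 : 2 ≤ Y := by omega
  have hd0 : 0 ≤ d := by omega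
  have he0 : 0 ≤ e := by omega
  have h3 : a - b ≤ Y + 1 + e := by omega
  subst he hd
  nlinarith [mul_nonneg hd0 he0, mul_nonneg he0 (by omega : 0 ≤ Y),
    mul_nonneg hd0 (by omega : 0 ≤ Y)]

/-- The optimization behind the isoperimetric inequality. -/
theorem eight_mul_add_le_of_projections {p q p' q' a b t : ℤ} (hp : 1 ≤ p) (hq : 1 ≤ q)
    (hp' : 1 ≤ p') (hq' : 1 ≤ q') (ha : a ≤ p * q) (hb : b ≤ p' * q')
    (h1 : p + q + p' + q' + 2 ≤ t) (h2 : p + q + 1 + a - b ≤ t) (h3 : p' + q' + 1 + b - a ≤ t) :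
    8 * (a + b) < (t - 2) ^ 2 - 1 ∨
      (8 * (a + b) + 8 * (p * q - a) + 8 * (p' * q' - b) + 2 * (p - q) ^ 2 + 2 * (p' - q') ^ 2 =
        (p + q + p' + q') ^ 2 + (p + q - p' - q') ^ 2 ∧ (p + q - p' - q') ^ 2 ≤ 4) := by
  by_cases hc : p' + q' + 3 ≤ p + q
  · exact Or.inl (eight_mul_add_lt hp' hq' hb h1 h2 hc)
  by_cases hc' : p + q + 3 ≤ p' + q'
  · left
    rw [add_comm a b]
    exact eight_mul_add_lt hp hq ha (by omega) h3 hc'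
  · right
    -- The identity combines `8pq + 2(p - q)² = 2(p + q)²`, its primed version, and `2X² + 2Y² = (X
    -- + Y)² + (X - Y)²`.
    exact ⟨by ring, by nlinarith⟩

/-- The case of a set inside one parity class. A single point may reach `(t - 2)² + 4`; with two or
more points neither extremal value occurs. -/
theorem eight_mul_le_of_projections {p q a t : ℤ} (hp : 1 ≤ p) (hq : 1 ≤ q) (ha1 : 1 ≤ a)
    (ha : a ≤ p * q) (ht : a + p + q + 1 ≤ t) :
    4 ≤ t ∧ 8 * a ≤ (t - 2) ^ 2 + 4 ∧ (2 ≤ a → 8 * a ≤ (t - 2) ^ 2 ∧ 8 * a ≠ (t - 2) ^ 2 - 1) := by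
  have h4 : 4 * a ≤ (p + q) ^ 2 := by nlinarith [sq_nonneg (p - q)]
  have hT : (a - 1 + (p + q)) ^ 2 ≤ (t - 2) ^ 2 := pow_le_pow_left₀ (by omega) (by omega) 2
  have hpq : 2 ≤ a → 3 ≤ p + q := by
    intro h
    by_contra hc
    have h1 : p = 1 := by omega
    have h2 : q = 1 := by omega
    subst h1 h2
    omega
  refine ⟨by omega, ?_, fun h2 => ?_⟩
  · nlinarith [mul_nonneg (by omega : 0 ≤ a - 1) (by omega : 0 ≤ p + q - 2)]
  · have h3 := hpq h2
    -- Two points with `t = 6` give `8a = (t - 2)²`, so the strict bound used for `a ≥ 3` fails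
    -- here.
    rcases eq_or_lt_of_le h2 with rfl | h2
    · have hT4 : 4 ≤ t - 2 := by omega
      rcases eq_or_lt_of_le hT4 with h | h
      · rw [← h]; norm_num
      · constructor
        · nlinarith
        · intro h; nlinarith
    · have : 8 * a < (t - 2) ^ 2 - 1 := by
        nlinarith [mul_nonneg (by omega : 0 ≤ a - 1) (by omega : 0 ≤ p + q - 3)]
      exact ⟨by omega, by omega⟩

/-- The vertices `(x, y)` with `u ≤ y - x ≤ u + a` and `v ≤ y + x ≤ v + b`. -/
def shiftedBox (u v a b : ℤ) : Set (ℤ × ℤ) :=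
  {p | u ≤ p.2 - p.1 ∧ p.2 - p.1 ≤ u + a ∧ v ≤ p.2 + p.1 ∧ p.2 + p.1 ≤ v + b}

theorem card_boundary_even_le {S T : Finset (ℤ × ℤ)} (hT : T.Nonempty) :
    T.card + (T.image Prod.fst).card + (T.image Prod.snd).card + 1 ≤
      (thicken T \ S).card + S.card :=
  (card_le_card_thicken hT).trans
    (by have := Finset.le_card_sdiff S (thicken T); omega)

theorem card_boundary_odd_le {S T : Finset (ℤ × ℤ)} (hS : S.Nonempty) :
    S.card + (S.image Prod.fst).card + (S.image Prod.snd).card + 1 ≤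
      (thickenNeg S \ T).card + T.card :=
  ((card_le_card_thicken hS).trans_eq (card_thickenNeg S).symm).trans
    (by have := Finset.le_card_sdiff T (thickenNeg S); omega)

/-- In the extremal case no point of one class may lie outside the neighbourhood of the other, as it
would not reduce the boundary. -/
theorem subset_of_card_sdiff_add_card_le {α : Type*} [DecidableEq α] {S D : Finset α}
    (h : (D \ S).card + S.card ≤ D.card) : S ⊆ D := by
  rw [Finset.card_sdiff] at h
  have h1 := Finset.card_le_card (Finset.inter_subset_right : S ∩ D ⊆ D)
  have h2 : S ∩ D = S := Finset.eq_of_subset_of_card_le Finset.inter_subset_left (by omega)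
  exact Finset.inter_eq_left.1 h2

/-- Two interlacing rectangles of vertices, one for each parity, make up a box. -/
theorem eq_shiftedBox_of_rectangles {A : Set (ℤ × ℤ)} {S T : Finset (ℤ × ℤ)}
    (hS : ∀ p, p ∈ S ↔ evenVertex p ∈ A) (hT : ∀ p, p ∈ T ↔ oddVertex p ∈ A)
    {i j i' j' p q p' q' : ℤ} (hp : 1 ≤ p) (hq : 1 ≤ q) (hp' : 1 ≤ p') (hq' : 1 ≤ q')
    (hSr : ∀ k l, (k, l) ∈ S ↔ (i ≤ k ∧ k < i + p) ∧ (j ≤ l ∧ l < j + q))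
    (hTr : ∀ k l, (k, l) ∈ T ↔ (i' ≤ k ∧ k < i' + p') ∧ (j' ≤ l ∧ l < j' + q'))
    (hST : S ⊆ thicken T) (hTS : T ⊆ thickenNeg S) :
    A = shiftedBox (min (2 * i) (2 * i' + 1)) (min (2 * j) (2 * j' + 1))
      (p + p' - 1) (q + q' - 1) ∧ (i' = i ∨ i' = i - 1) ∧ (j' = j ∨ j' = j - 1) ∧
      (i' + p' = i + p ∨ i' + p' = i + p - 1) ∧ (j' + q' = j + q ∨ j' + q' = j + q - 1) := by
  -- Testing the two inclusions at opposite corners shows that the endpoints of the intervals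
  -- interlace.
  have h1 := hST ((hSr i j).2 (by omega))
  have h2 := hST ((hSr (i + p - 1) (j + q - 1)).2 (by omega))
  have h3 := hTS ((hTr i' j').2 (by omega))
  have h4 := hTS ((hTr (i' + p' - 1) (j' + q' - 1)).2 (by omega))
  rw [mem_thicken, hTr, hTr, hTr, hTr] at h1 h2
  rw [mem_thickenNeg, hSr, hSr, hSr, hSr] at h3 h4
  have hi : i' = i ∨ i' = i - 1 := by omega
  have hj : j' = j ∨ j' = j - 1 := by omega
  have hip : i' + p' = i + p ∨ i' + p' = i + p - 1 := by omega
  have hjq : j' + q' = j + q ∨ j' + q' = j + q - 1 := by omega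
  refine ⟨?_, hi, hj, hip, hjq⟩
  clear h1 h2 h3 h4
  ext x
  rcases exists_eq_evenVertex_or_oddVertex x with ⟨⟨k, l⟩, rfl⟩ | ⟨⟨k, l⟩, rfl⟩
  · rw [← hS, hSr]
    simp only [evenVertex, shiftedBox, Set.mem_ofPred_eq]
    have e1 : k + l - (l - k) = 2 * k := by ring
    have e2 : k + l + (l - k) = 2 * l := by ring
    rw [e1, e2]
    have f1 : i ≤ k ∧ k < i + p ↔ min (2 * i) (2 * i' + 1) ≤ 2 * k ∧
      2 * k ≤ min (2 * i) (2 * i' + 1) + (p + p' - 1) := by omega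
    have f2 : j ≤ l ∧ l < j + q ↔ min (2 * j) (2 * j' + 1) ≤ 2 * l ∧
      2 * l ≤ min (2 * j) (2 * j' + 1) + (q + q' - 1) := by omega
    rw [f1, f2, and_assoc]
  · rw [← hT, hTr]
    simp only [oddVertex, shiftedBox, Set.mem_ofPred_eq]
    have e1 : k + l + 1 - (l - k) = 2 * k + 1 := by ring
    have e2 : k + l + 1 + (l - k) = 2 * l + 1 := by ring
    rw [e1, e2]
    have f1 : i' ≤ k ∧ k < i' + p' ↔ min (2 * i) (2 * i' + 1) ≤ 2 * k + 1 ∧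
      2 * k + 1 ≤ min (2 * i) (2 * i' + 1) + (p + p' - 1) := by omega
    have f2 : j' ≤ l ∧ l < j' + q' ↔ min (2 * j) (2 * j' + 1) ≤ 2 * l + 1 ∧
      2 * l + 1 ≤ min (2 * j) (2 * j' + 1) + (q + q' - 1) := by omega
    rw [f1, f2, and_assoc]

/-- Equality in the isoperimetric inequality makes every non-negative slack term vanish and forces
`(X - Y)² = 4`. -/
theorem extremal_even_arith {p q p' q' a b t : ℤ} (hp : 1 ≤ p) (hq : 1 ≤ q)
    (hp' : 1 ≤ p') (hq' : 1 ≤ q') (ha : a ≤ p * q) (hb : b ≤ p' * q')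
    (h1 : p + q + p' + q' + 2 ≤ t)
    (h : 8 * (a + b) + 8 * (p * q - a) + 8 * (p' * q' - b) + 2 * (p - q) ^ 2 +
      2 * (p' - q') ^ 2 = (p + q + p' + q') ^ 2 + (p + q - p' - q') ^ 2)
    (hd : (p + q - p' - q') ^ 2 ≤ 4) (he : 8 * (a + b) = (t - 2) ^ 2 + 4) :
    a = p * q ∧ b = p' * q' ∧ t = p + q + p' + q' + 2 ∧ p = q ∧ p' = q' ∧
      (p = p' + 1 ∨ p' = p + 1) := by
  have ht : t = p + q + p' + q' + 2 := by
    by_contra hne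
    have hsq : (p + q + p' + q' + 1) ^ 2 ≤ (t - 2) ^ 2 :=
      pow_le_pow_left₀ (by omega) (by omega) 2
    rw [show (p + q + p' + q' + 1) ^ 2 = (p + q + p' + q') ^ 2 + 2 * (p + q + p' + q') + 1 by
      ring] at hsq
    linarith [sq_nonneg (p - q), sq_nonneg (p' - q')]
  subst ht
  rw [add_sub_cancel_right] at he
  have g1 := sq_nonneg (p - q)
  have g2 := sq_nonneg (p' - q')
  have e1 : a = p * q := by omega
  have e2 : b = p' * q' := by omega
  have e3 : (p - q) ^ 2 = 0 := by omega
  have e4 : (p' - q') ^ 2 = 0 := by omega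
  have e5 : (p + q - p' - q') ^ 2 = 4 := by omega
  have e6 : p = q := sub_eq_zero.1 (pow_eq_zero_iff two_ne_zero |>.1 e3)
  have e7 : p' = q' := sub_eq_zero.1 (pow_eq_zero_iff two_ne_zero |>.1 e4)
  refine ⟨e1, e2, rfl, e6, e7, ?_⟩
  subst e6 e7
  have : (p - p' - 1) * (p - p' + 1) = 0 := by nlinarith
  rcases mul_eq_zero.1 this with h | h <;> omega

/-- Divisibility by 8 makes `X + Y` odd, so `(X - Y)² = 1` and the slack terms total 2. Defects of
area are weighted by 8 and must vanish; exactly one of `p - q`, `p' - q'` is `±1` and the other is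
zero. -/
theorem extremal_odd_arith {p q p' q' a b t : ℤ} (hp : 1 ≤ p) (hq : 1 ≤ q)
    (hp' : 1 ≤ p') (hq' : 1 ≤ q') (ha : a ≤ p * q) (hb : b ≤ p' * q')
    (h1 : p + q + p' + q' + 2 ≤ t)
    (h : 8 * (a + b) + 8 * (p * q - a) + 8 * (p' * q' - b) + 2 * (p - q) ^ 2 +
      2 * (p' - q') ^ 2 = (p + q + p' + q') ^ 2 + (p + q - p' - q') ^ 2)
    (hd : (p + q - p' - q') ^ 2 ≤ 4) (he : 8 * (a + b) = (t - 2) ^ 2 - 1) :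
    a = p * q ∧ b = p' * q' ∧ t = p + q + p' + q' + 2 ∧
      ((p + p' = q + q' + 1) ∨ (q + q' = p + p' + 1)) := by
  have ht : t = p + q + p' + q' + 2 := by
    by_contra hne
    have hsq : (p + q + p' + q' + 1) ^ 2 ≤ (t - 2) ^ 2 :=
      pow_le_pow_left₀ (by omega) (by omega) 2
    rw [show (p + q + p' + q' + 1) ^ 2 = (p + q + p' + q') ^ 2 + 2 * (p + q + p' + q') + 1 by
      ring] at hsq
    linarith [sq_nonneg (p - q), sq_nonneg (p' - q')]
  subst ht
  have hodd : (p + q + p' + q') % 2 = 1 := by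
    by_contra hne
    obtain ⟨k, hk⟩ : ∃ k, p + q + p' + q' = 2 * k := ⟨(p + q + p' + q') / 2, by omega⟩
    rw [show p + q + p' + q' + 2 - 2 = 2 * k by omega] at he
    have : (2 * k) ^ 2 = 4 * k ^ 2 := by ring
    omega
  obtain ⟨x, hx⟩ : ∃ x, x = p + q - p' - q' := ⟨_, rfl⟩
  obtain ⟨y, hy⟩ : ∃ y, y = p - q := ⟨_, rfl⟩
  obtain ⟨z, hz⟩ : ∃ z, z = p' - q' := ⟨_, rfl⟩
  rw [← hx] at hd h
  rw [← hy, ← hz] at h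
  have hx2 : x = 1 ∨ x = -1 := by
    have : -2 ≤ x := by nlinarith
    have : x ≤ 2 := by nlinarith
    omega
  have hx3 : x ^ 2 = 1 := by rcases hx2 with h | h <;> rw [h] <;> norm_num
  have key : 8 * (p * q - a) + 8 * (p' * q' - b) + 2 * y ^ 2 + 2 * z ^ 2 = 2 := by
    rw [add_sub_cancel_right] at he
    omega
  have hy0 := sq_nonneg y
  have hz0 := sq_nonneg z
  have hy1 : -1 ≤ y := by nlinarith
  have hy2 : y ≤ 1 := by nlinarith
  have hz1 : -1 ≤ z := by nlinarith
  have hz2 : z ≤ 1 := by nlinarith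
  have hyz : y = 0 ∨ z = 0 := by
    by_contra hc
    push Not at hc
    have h1 : 1 ≤ y ^ 2 := by have := pow_pos (abs_pos.2 hc.1) 2; rw [sq_abs] at this; omega
    have h2 : 1 ≤ z ^ 2 := by have := pow_pos (abs_pos.2 hc.2) 2; rw [sq_abs] at this; omega
    omega
  exact ⟨by omega, by omega, by omega, by omega⟩

/-- The vertex-isoperimetric inequality in the square lattice. -/
theorem eight_mul_card_le {A : Set (ℤ × ℤ)} {a t : ℕ} (hA : A.encard = a) (ha : 1 ≤ a)
    (ht : (vertexBoundary latticeGraph A).encard = t) :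
    4 ≤ t ∧ 8 * (a : ℤ) ≤ ((t : ℤ) - 2) ^ 2 + 4 := by
  obtain ⟨S, T, hS, hT⟩ := exists_parity_finsets (Set.finite_of_encard_eq_coe hA)
  have hcA := encard_eq_card_add_card hS hT
  have hct := encard_eq_card_add_card (evenVertex_mem_vertexBoundary hS hT)
    (oddVertex_mem_vertexBoundary hS hT)
  rw [hA, Nat.cast_inj] at hcA
  rw [ht, Nat.cast_inj] at hct
  have hS2 := card_le_card_fst_mul_card_snd S
  have hT2 := card_le_card_fst_mul_card_snd T
  have pos : ∀ {R : Finset (ℤ × ℤ)}, R.Nonempty → 1 ≤ R.card ∧ 1 ≤ (R.image Prod.fst).card ∧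
      1 ≤ (R.image Prod.snd).card := fun h =>
    ⟨h.card_pos, (h.image _).card_pos, (h.image _).card_pos⟩
  rcases S.eq_empty_or_nonempty with h0 | h0
  · have hTn : T.Nonempty := by
      rw [← Finset.card_pos]
      rw [h0, Finset.card_empty] at hcA
      omega
    have hb := card_boundary_even_le (S := S) hTn
    obtain ⟨h1, h2, h3⟩ := pos hTn
    rw [h0, Finset.card_empty] at hcA hb
    rw [h0] at hct
    have := eight_mul_le_of_projections (p := (T.image Prod.fst).card)
      (q := (T.image Prod.snd).card) (a := a) (t := t) (by omega) (by omega) (by omega)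
      (by push_cast [hcA]; rw [zero_add]; exact_mod_cast hT2) (by omega)
    exact ⟨by omega, this.2.1⟩
  rcases T.eq_empty_or_nonempty with h0' | h0'
  · have hb := card_boundary_odd_le (T := T) h0
    obtain ⟨h1, h2, h3⟩ := pos h0
    rw [h0', Finset.card_empty] at hcA hb
    rw [h0'] at hct
    have := eight_mul_le_of_projections (p := (S.image Prod.fst).card)
      (q := (S.image Prod.snd).card) (a := a) (t := t) (by omega) (by omega) (by omega)
      (by push_cast [hcA]; rw [add_zero]; exact_mod_cast hS2) (by omega)
    exact ⟨by omega, this.2.1⟩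
  have hb := card_boundary_even_le (S := S) h0'
  have hb' := card_boundary_odd_le (T := T) h0
  obtain ⟨h1, h2, h3⟩ := pos h0
  obtain ⟨h1', h2', h3'⟩ := pos h0'
  refine ⟨by omega, ?_⟩
  have hac : (a : ℤ) = S.card + T.card := by exact_mod_cast hcA
  rw [hac]
  rcases eight_mul_add_le_of_projections (p := (S.image Prod.fst).card)
    (q := (S.image Prod.snd).card) (p' := (T.image Prod.fst).card)
    (q' := (T.image Prod.snd).card) (a := S.card) (b := T.card) (t := t) (by omega) (by omega)
    (by omega) (by omega) (by exact_mod_cast hS2) (by exact_mod_cast hT2) (by omega) (by omega)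
    (by omega) with h | ⟨h, hd⟩
  · omega
  -- Here `X + Y ≤ t - 2` and `(X - Y)² ≤ 4`; the remaining terms of the identity are non-negative.
  · have hsq := pow_le_pow_left₀ (n := 2) (a := ((S.image Prod.fst).card +
      (S.image Prod.snd).card + (T.image Prod.fst).card + (T.image Prod.snd).card : ℤ))
      (b := (t : ℤ) - 2) (by omega) (by omega)
    have hS2' : (S.card : ℤ) ≤ (S.image Prod.fst).card * (S.image Prod.snd).card := by
      exact_mod_cast hS2
    have hT2' : (T.card : ℤ) ≤ (T.image Prod.fst).card * (T.image Prod.snd).card := by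
      exact_mod_cast hT2
    have g1 := sq_nonneg ((S.image Prod.fst).card - (S.image Prod.snd).card : ℤ)
    have g2 := sq_nonneg ((T.image Prod.fst).card - (T.image Prod.snd).card : ℤ)
    linarith

/-- Sets that are extremal for the vertex-isoperimetric inequality are boxes. -/
theorem eq_shiftedBox_of_extremal {A : Set (ℤ × ℤ)} {a t : ℕ} (hA : A.encard = a) (ha : 2 ≤ a)
    (ht : (vertexBoundary latticeGraph A).encard = t)
    (hext : 8 * (a : ℤ) = ((t : ℤ) - 2) ^ 2 + 4 ∨ 8 * (a : ℤ) = ((t : ℤ) - 2) ^ 2 - 1) :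
    ∃ u v α β : ℤ, A = shiftedBox u v α β ∧ (t : ℤ) = α + β + 4 ∧
      (8 * (a : ℤ) = ((t : ℤ) - 2) ^ 2 + 4 → α = β ∧ (v - u) % 2 = 0) ∧
      (8 * (a : ℤ) = ((t : ℤ) - 2) ^ 2 - 1 → α = β + 1 ∨ β = α + 1) := by
  obtain ⟨S, T, hS, hT⟩ := exists_parity_finsets (Set.finite_of_encard_eq_coe hA)
  have hcA := encard_eq_card_add_card hS hT
  have hct := encard_eq_card_add_card (evenVertex_mem_vertexBoundary hS hT)
    (oddVertex_mem_vertexBoundary hS hT)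
  rw [hA, Nat.cast_inj] at hcA
  rw [ht, Nat.cast_inj] at hct
  have hS2 := card_le_card_fst_mul_card_snd S
  have hT2 := card_le_card_fst_mul_card_snd T
  have pos : ∀ {R : Finset (ℤ × ℤ)}, R.Nonempty → 1 ≤ R.card ∧ 1 ≤ (R.image Prod.fst).card ∧
      1 ≤ (R.image Prod.snd).card := fun h =>
    ⟨h.card_pos, (h.image _).card_pos, (h.image _).card_pos⟩
  rcases S.eq_empty_or_nonempty with h0 | h0
  · have hTn : T.Nonempty := by
      rw [← Finset.card_pos]
      rw [h0, Finset.card_empty] at hcA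
      omega
    have hb := card_boundary_even_le (S := S) hTn
    obtain ⟨h1, h2, h3⟩ := pos hTn
    rw [h0, Finset.card_empty] at hcA hb
    rw [h0] at hct
    have := eight_mul_le_of_projections (p := (T.image Prod.fst).card)
      (q := (T.image Prod.snd).card) (a := a) (t := t) (by omega) (by omega) (by omega)
      (by push_cast [hcA]; rw [zero_add]; exact_mod_cast hT2) (by omega)
    -- A set of at least two points inside one class is never extremal.
    have := this.2.2 (by omega)
    omega
  rcases T.eq_empty_or_nonempty with h0' | h0'
  · have hb := card_boundary_odd_le (T := T) h0
    obtain ⟨h1, h2, h3⟩ := pos h0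
    rw [h0', Finset.card_empty] at hcA hb
    rw [h0'] at hct
    have := eight_mul_le_of_projections (p := (S.image Prod.fst).card)
      (q := (S.image Prod.snd).card) (a := a) (t := t) (by omega) (by omega) (by omega)
      (by push_cast [hcA]; rw [add_zero]; exact_mod_cast hS2) (by omega)
    have := this.2.2 (by omega)
    omega
  have hb := card_boundary_even_le (S := S) h0'
  have hb' := card_boundary_odd_le (T := T) h0
  obtain ⟨h1, h2, h3⟩ := pos h0
  obtain ⟨h1', h2', h3'⟩ := pos h0'
  have hsdS := Finset.le_card_sdiff S (thicken T)
  have hsdT := Finset.le_card_sdiff T (thickenNeg S)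
  have hcS := card_le_card_thicken h0
  have hcT := card_le_card_thicken h0'
  have hneg := card_thickenNeg S
  have hac : (a : ℤ) = S.card + T.card := by exact_mod_cast hcA
  rw [hac] at hext ⊢
  rcases eight_mul_add_le_of_projections (p := (S.image Prod.fst).card)
    (q := (S.image Prod.snd).card) (p' := (T.image Prod.fst).card)
    (q' := (T.image Prod.snd).card) (a := S.card) (b := T.card) (t := t) (by omega) (by omega)
    (by omega) (by omega) (by exact_mod_cast hS2) (by exact_mod_cast hT2) (by omega) (by omega)
    (by omega) with h | ⟨h, hd⟩
  · omega
  have rect : (S.card : ℤ) = (S.image Prod.fst).card * (S.image Prod.snd).card →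
      (T.card : ℤ) = (T.image Prod.fst).card * (T.image Prod.snd).card →
      (t : ℤ) = (S.image Prod.fst).card + (S.image Prod.snd).card + (T.image Prod.fst).card +
        (T.image Prod.snd).card + 2 →
      ∃ i j i' j' : ℤ, A = shiftedBox (min (2 * i) (2 * i' + 1)) (min (2 * j) (2 * j' + 1))
        ((S.image Prod.fst).card + (T.image Prod.fst).card - 1)
        ((S.image Prod.snd).card + (T.image Prod.snd).card - 1) ∧
        (i' = i ∨ i' = i - 1) ∧ (j' = j ∨ j' = j - 1) ∧
        (i' + (T.image Prod.fst).card = i + (S.image Prod.fst).card ∨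
          i' + (T.image Prod.fst).card = i + (S.image Prod.fst).card - 1) ∧
        (j' + (T.image Prod.snd).card = j + (S.image Prod.snd).card ∨
          j' + (T.image Prod.snd).card = j + (S.image Prod.snd).card - 1) := by
    intro e1 e2 e3
    obtain ⟨i, j, hij⟩ := eq_rectangle_of_card_thicken_le h0
      (by rw [← Nat.cast_mul, Nat.cast_inj] at e1; exact e1.ge) (by omega)
    obtain ⟨i', j', hij'⟩ := eq_rectangle_of_card_thicken_le h0'
      (by rw [← Nat.cast_mul, Nat.cast_inj] at e2; exact e2.ge) (by omega)
    exact ⟨i, j, i', j', eq_shiftedBox_of_rectangles hS hT (by omega) (by omega) (by omega)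
      (by omega) hij hij' (subset_of_card_sdiff_add_card_le (by omega))
      (subset_of_card_sdiff_add_card_le (by omega))⟩
  rcases hext with he | he
  · obtain ⟨e1, e2, e3, e4, e5, e6⟩ := extremal_even_arith (by omega) (by omega) (by omega)
      (by omega) (by exact_mod_cast hS2) (by exact_mod_cast hT2) (by omega) h hd he
    obtain ⟨i, j, i', j', hbox, hi, hj, hi', hj'⟩ := rect e1 e2 e3
    exact ⟨_, _, _, _, hbox, by omega, fun _ => ⟨by omega, by omega⟩, by omega⟩
  · obtain ⟨e1, e2, e3, e4⟩ := extremal_odd_arith (by omega) (by omega) (by omega)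
      (by omega) (by exact_mod_cast hS2) (by exact_mod_cast hT2) (by omega) h hd he
    obtain ⟨i, j, i', j', hbox, -⟩ := rect e1 e2 e3
    exact ⟨_, _, _, _, hbox, by omega, by omega, fun _ => by omega⟩

/-! ### Congruence -/

section Congruence

variable {V : Type*} {G : SimpleGraph V} {A B C : Set V}

theorem CongruentSets.symm (h : CongruentSets G A B) : CongruentSets G B A := by
  obtain ⟨φ, rfl⟩ := h
  refine ⟨φ.symm, ?_⟩
  rw [Set.image_image]
  simp

theorem CongruentSets.trans (h : CongruentSets G A B) (h' : CongruentSets G B C) :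
    CongruentSets G A C := by
  obtain ⟨φ, rfl⟩ := h
  obtain ⟨ψ, rfl⟩ := h'
  exact ⟨φ.trans ψ, by rw [Set.image_image]; rfl⟩

theorem image_vertexBoundary (φ : G ≃g G) (A : Set V) :
    vertexBoundary G (φ '' A) = φ '' vertexBoundary G A := by
  ext u
  constructor
  · rintro ⟨hu, _, ⟨v, hv, rfl⟩, hadj⟩
    refine ⟨φ.symm u, ⟨fun h => hu ⟨_, h, by simp⟩, v, hv, ?_⟩, by simp⟩
    rw [← φ.map_adj_iff]
    simpa using hadj
  · rintro ⟨w, ⟨hw, v, hv, hadj⟩, rfl⟩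
    refine ⟨?_, φ v, ⟨v, hv, rfl⟩, φ.map_adj_iff.2 hadj⟩
    rintro ⟨x, hx, h⟩
    exact hw (φ.injective h ▸ hx)

theorem CongruentSets.encard_eq (h : CongruentSets G A B) : A.encard = B.encard := by
  obtain ⟨φ, rfl⟩ := h
  exact (φ.injective.encard_image A).symm

theorem CongruentSets.encard_vertexBoundary_eq (h : CongruentSets G A B) :
    (vertexBoundary G A).encard = (vertexBoundary G B).encard := by
  obtain ⟨φ, rfl⟩ := h
  rw [image_vertexBoundary]
  exact (φ.injective.encard_image _).symm

theorem CongruentSets.isUniquelyMinimal (h : CongruentSets G A B) (hB : IsUniquelyMinimal G B) :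
    IsUniquelyMinimal G A := by
  refine ⟨fun C hC => ?_, fun C hC hcard => ?_⟩
  · rw [h.encard_vertexBoundary_eq]
    exact hB.1 C (hC.trans h.encard_eq)
  · exact (hB.2 C hC (hcard.trans h.encard_eq)).trans h.symm

end Congruence

theorem exists_adj_of_l1_pos {p q : ℤ × ℤ} (h : p ≠ q) : ∃ r, latticeGraph.Adj p r ∧
    |p.1 - q.1| + |p.2 - q.2| = |r.1 - q.1| + |r.2 - q.2| + 1 := by
  obtain ⟨x, y⟩ := p
  obtain ⟨a, b⟩ := q
  simp only [ne_eq, Prod.mk.injEq] at h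
  have habs : ∀ z w : ℤ, w < z → |z - w| = |z - 1 - w| + 1 := fun z w h => by
    rw [abs_of_nonneg (by omega), abs_of_nonneg (by omega)]
    ring
  have habs' : ∀ z w : ℤ, z < w → |z - w| = |z + 1 - w| + 1 := fun z w h => by
    rw [abs_of_nonpos (by omega), abs_of_nonpos (by omega)]
    ring
  rcases lt_trichotomy x a with hx | hx | hx
  · exact ⟨(x + 1, y), latticeGraph_adj_iff.2 (by omega), by
      have := habs' x a hx; dsimp only; omega⟩
  · rcases lt_trichotomy y b with hy | hy | hy
    · exact ⟨(x, y + 1), latticeGraph_adj_iff.2 (by omega), by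
        have := habs' y b hy; dsimp only; omega⟩
    · exact absurd ⟨hx, hy⟩ h
    · exact ⟨(x, y - 1), latticeGraph_adj_iff.2 (by omega), by
        have := habs y b hy; dsimp only; omega⟩
  · exact ⟨(x - 1, y), latticeGraph_adj_iff.2 (by omega), by
      have := habs x a hx; dsimp only; omega⟩

/-- Automorphisms of the lattice graph do not increase `ℓ¹`-distances. -/
theorem l1_map_le (φ : latticeGraph ≃g latticeGraph) (p q : ℤ × ℤ) :
    |(φ p).1 - (φ q).1| + |(φ p).2 - (φ q).2| ≤ |p.1 - q.1| + |p.2 - q.2| := by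
  obtain ⟨n, hn⟩ : ∃ n : ℕ, |p.1 - q.1| + |p.2 - q.2| = n :=
    Int.eq_ofNat_of_zero_le (by positivity)
  induction n generalizing p with
  | zero =>
    have h1 := abs_nonneg (p.1 - q.1)
    have h2 := abs_nonneg (p.2 - q.2)
    have h3 : p.1 - q.1 = 0 := abs_eq_zero.1 (by push_cast at hn; omega)
    have h4 : p.2 - q.2 = 0 := abs_eq_zero.1 (by push_cast at hn; omega)
    obtain rfl : p = q := Prod.ext (by omega) (by omega)
    simp
  | succ n ih =>
    have hpq : p ≠ q := by
      rintro rfl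
      simp at hn
      omega
    obtain ⟨r, hr, hd⟩ := exists_adj_of_l1_pos hpq
    have h1 := ih r (by push_cast at hn; omega)
    have h2 : |(φ p).1 - (φ r).1| + |(φ p).2 - (φ r).2| = 1 := φ.map_adj_iff.2 hr
    have h3 := abs_sub_le (φ p).1 (φ r).1 (φ q).1
    have h4 := abs_sub_le (φ p).2 (φ r).2 (φ q).2
    omega

/-- In diagonal coordinates the `ℓ¹`-distance is a maximum, so the longer side of a box bounds its
diameter. -/
theorem l1_eq (p q : ℤ × ℤ) : |p.1 - q.1| + |p.2 - q.2| =
    max |(p.2 - p.1) - (q.2 - q.1)| |(p.2 + p.1) - (q.2 + q.1)| := by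
  simp only [abs_eq_max_neg]
  omega

/-- A set with an `ℓ¹`-distance larger than every `ℓ¹`-distance of another set is not congruent to
that set. -/
theorem not_congruentSets_of_l1_lt {A B : Set (ℤ × ℤ)} {p q : ℤ × ℤ} (hp : p ∈ B) (hq : q ∈ B)
    (h : ∀ x ∈ A, ∀ y ∈ A, |x.1 - y.1| + |x.2 - y.2| < |p.1 - q.1| + |p.2 - q.2|) :
    ¬ CongruentSets latticeGraph A B := by
  rintro ⟨φ, rfl⟩
  obtain ⟨x, hx, rfl⟩ := hp
  obtain ⟨y, hy, rfl⟩ := hq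
  exact absurd (h x hx y hy) (l1_map_le φ x y).not_gt

/-- Translation by `(c, d)` as an automorphism of the lattice graph. -/
def translationIso (c d : ℤ) : latticeGraph ≃g latticeGraph where
  toFun p := (p.1 + c, p.2 + d)
  invFun p := (p.1 - c, p.2 - d)
  left_inv p := by simp
  right_inv p := by simp
  map_rel_iff' := by
    rintro ⟨a, b⟩ ⟨a', b'⟩
    simp only [Equiv.coe_fn_mk, latticeGraph_adj_iff]
    omega

/-- The reflection exchanging the coordinates as an automorphism of the lattice graph. -/
def swapIso : latticeGraph ≃g latticeGraph where
  toFun p := (p.2, p.1)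
  invFun p := (p.2, p.1)
  left_inv p := rfl
  right_inv p := rfl
  map_rel_iff' := by
    rintro ⟨a, b⟩ ⟨a', b'⟩
    simp only [Equiv.coe_fn_mk, latticeGraph_adj_iff]
    omega

/-- The reflection negating the first coordinate as an automorphism of the lattice graph. -/
def negFstIso : latticeGraph ≃g latticeGraph where
  toFun p := (-p.1, p.2)
  invFun p := (-p.1, p.2)
  left_inv p := by simp
  right_inv p := by simp
  map_rel_iff' := by
    rintro ⟨a, b⟩ ⟨a', b'⟩
    simp only [Equiv.coe_fn_mk, latticeGraph_adj_iff]
    omega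

theorem congruentSets_of_mem_iff (φ : latticeGraph ≃g latticeGraph) {A B : Set (ℤ × ℤ)}
    (h : ∀ p, φ p ∈ B ↔ p ∈ A) : CongruentSets latticeGraph A B := by
  refine ⟨φ, ?_⟩
  ext p
  constructor
  · rintro ⟨q, hq, rfl⟩
    exact (h q).2 hq
  · intro hp
    exact ⟨φ.symm p, (h _).1 (by simpa using hp), by simp⟩

theorem shiftedBox_congruentSets_translation (u v α β : ℤ) (h : (v - u) % 2 = 0) :
    CongruentSets latticeGraph (shiftedBox u v α β) (shiftedBox 0 0 α β) := by
  refine congruentSets_of_mem_iff (translationIso (-((v - u) / 2)) (-u - (v - u) / 2)) ?_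
  rintro ⟨x, y⟩
  change (_ ∧ _ ∧ _ ∧ _) ↔ (_ ∧ _ ∧ _ ∧ _)
  simp only [translationIso, RelIso.coe_fn_mk, Equiv.coe_fn_mk]
  omega

theorem shiftedBox_congruentSets_swap (u v α β : ℤ) :
    CongruentSets latticeGraph (shiftedBox u v α β) (shiftedBox (-u - α) v α β) := by
  refine congruentSets_of_mem_iff swapIso ?_
  rintro ⟨x, y⟩
  change (_ ∧ _ ∧ _ ∧ _) ↔ (_ ∧ _ ∧ _ ∧ _)
  simp only [swapIso, RelIso.coe_fn_mk, Equiv.coe_fn_mk]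
  omega

theorem shiftedBox_congruentSets_negFst (u v α β : ℤ) :
    CongruentSets latticeGraph (shiftedBox u v α β) (shiftedBox v u β α) := by
  refine congruentSets_of_mem_iff negFstIso ?_
  rintro ⟨x, y⟩
  change (_ ∧ _ ∧ _ ∧ _) ↔ (_ ∧ _ ∧ _ ∧ _)
  simp only [negFstIso, RelIso.coe_fn_mk, Equiv.coe_fn_mk]
  omega

theorem latticeBox_eq_shiftedBox (α β : ℕ) : latticeBox α β = shiftedBox 0 0 α β := by
  simp [latticeBox, shiftedBox]

/-- Translations preserve the parity of `v - u`. The coordinate swap replaces `u` by `-u - α`, which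
changes that parity when `α` is odd. -/
theorem shiftedBox_congruentSets_of_odd_fst (u v α β : ℤ) (h : α % 2 = 1) :
    CongruentSets latticeGraph (shiftedBox u v α β) (shiftedBox 0 0 α β) := by
  by_cases hp : (v - u) % 2 = 0
  · exact shiftedBox_congruentSets_translation u v α β hp
  · exact (shiftedBox_congruentSets_swap u v α β).trans
      (shiftedBox_congruentSets_translation _ _ _ _ (by omega))

/-- If a side length is odd, the position of a box is irrelevant up to congruence. -/
theorem shiftedBox_congruentSets_of_odd (u v α β : ℤ) (h : α % 2 = 1 ∨ β % 2 = 1) :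
    CongruentSets latticeGraph (shiftedBox u v α β) (shiftedBox 0 0 α β) := by
  rcases h with h | h
  · exact shiftedBox_congruentSets_of_odd_fst u v α β h
  · exact (shiftedBox_congruentSets_negFst u v α β).trans
      ((shiftedBox_congruentSets_of_odd_fst v u β α h).trans
        (shiftedBox_congruentSets_negFst 0 0 β α))

/-! ### Boxes with points removed from a side -/

theorem card_range_filter_parity (N v : ℕ) :
    ((Finset.range N).filter fun u => (u + v) % 2 = 0).card = (N + 1 - v % 2) / 2 := by
  induction N with
  | zero => simp; omega
  | succ N ih =>
    rw [Finset.range_add_one, Finset.filter_insert]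
    split_ifs with h
    · rw [Finset.card_insert_of_notMem (by simp), ih]
      omega
    · rw [ih]
      omega

theorem sum_half_eq (N M : ℕ) :
    ∑ v ∈ Finset.range M, (N + 1 - v % 2) / 2 = (N * M + 1) / 2 := by
  induction M with
  | zero => simp
  | succ M ih =>
    rw [Finset.sum_range_succ, ih, Nat.mul_succ]
    rcases Nat.even_or_odd' M with ⟨k, rfl | rfl⟩
    · have : N * (2 * k) = 2 * (N * k) := by ring
      omega
    · have : N * (2 * k + 1) = 2 * (N * k) + N := by ring
      omega

/-- The points correspond to the pairs `(y - x, y + x)` of equal parity in an `(α + 1) × (β + 1)`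
grid whose corner `(0, 0)` is counted. -/
theorem encard_latticeBox (α β : ℕ) :
    (latticeBox α β).encard = (((α + 1) * (β + 1) + 1) / 2 : ℕ) := by
  set F := (Finset.range (β + 1)).sigma fun v =>
    (Finset.range (α + 1)).filter fun u => (u + v) % 2 = 0 with hF
  have hcard : F.card = ((α + 1) * (β + 1) + 1) / 2 := by
    rw [hF, Finset.card_sigma, ← sum_half_eq]
    exact Finset.sum_congr rfl fun v _ => card_range_filter_parity _ _
  rw [← hcard, ← Set.encard_coe_eq_coe_finsetCard]
  set f : (_ : ℕ) × ℕ → ℤ × ℤ := fun s => (((s.1 : ℤ) - s.2) / 2, ((s.1 : ℤ) + s.2) / 2) with hf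
  have hinj : Set.InjOn f F := by
    rintro ⟨v, u⟩ h ⟨v', u'⟩ h' heq
    simp only [hF, Finset.coe_sigma, Set.mem_sigma_iff, Finset.mem_coe, Finset.mem_filter,
      Finset.mem_range] at h h'
    simp only [hf, Prod.mk.injEq] at heq
    obtain rfl : v = v' := by omega
    obtain rfl : u = u' := by omega
    rfl
  rw [← hinj.encard_image]
  congr 1
  ext ⟨x, y⟩
  constructor
  · rintro ⟨h1, h2, h3, h4⟩
    simp only at h1 h2 h3 h4
    refine ⟨⟨(y + x).toNat, (y - x).toNat⟩, ?_, ?_⟩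
    · simp only [hF, Finset.coe_sigma, Set.mem_sigma_iff, Finset.mem_coe, Finset.mem_filter,
        Finset.mem_range]
      omega
    · simp only [hf, Prod.mk.injEq]
      omega
  · rintro ⟨⟨v, u⟩, h, heq⟩
    simp only [hF, Finset.coe_sigma, Set.mem_sigma_iff, Finset.mem_coe, Finset.mem_filter,
        Finset.mem_range] at h
    simp only [hf, Prod.mk.injEq] at heq
    change _ ∧ _ ∧ _ ∧ _
    omega

/-- A box with the first `j` points of the side on `y + x = 0` removed. -/
def truncatedBox (α β j : ℕ) : Set (ℤ × ℤ) :=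
  latticeBox α β \ {p | p.2 + p.1 = 0 ∧ p.2 - p.1 < 2 * j}

theorem encard_removed (j : ℕ) (c : ℤ) :
    ((fun i : ℕ => ((-i : ℤ), (i : ℤ) + c)) '' (Finset.range j : Set ℕ)).encard = j := by
  rw [Function.Injective.encard_image, Set.encard_coe_eq_coe_finsetCard, Finset.card_range]
  intro a b h
  simp only [Prod.mk.injEq] at h
  omega

theorem encard_truncatedBox {α β j : ℕ} (hj : 2 * j ≤ α + 2) :
    (truncatedBox α β j).encard = (((α + 1) * (β + 1) + 1) / 2 - j : ℕ) := by
  have hset : truncatedBox α β j =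
      latticeBox α β \ ((fun i : ℕ => ((-i : ℤ), (i : ℤ) + 0)) '' (Finset.range j : Set ℕ)) := by
    ext ⟨x, y⟩
    refine and_congr_right fun h => not_congr ?_
    obtain ⟨h1, h2, h3, h4⟩ := h
    simp only [Set.mem_ofPred_eq, Set.mem_image, Finset.mem_coe, Finset.mem_range,
      Prod.mk.injEq] at *
    constructor
    · intro h
      exact ⟨y.toNat, by omega⟩
    · rintro ⟨i, hi⟩
      omega
  have hsub : (fun i : ℕ => ((-i : ℤ), (i : ℤ) + 0)) '' (Finset.range j : Set ℕ) ⊆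
      latticeBox α β := by
    rintro _ ⟨i, hi, rfl⟩
    rw [Finset.mem_coe, Finset.mem_range] at hi
    change _ ∧ _ ∧ _ ∧ _
    dsimp only
    omega
  have := Set.encard_sdiff_add_encard_of_subset hsub
  rw [encard_removed, encard_latticeBox, ← hset] at this
  have hfin : (truncatedBox α β j).Finite :=
    (Set.finite_of_encard_eq_coe (encard_latticeBox α β)).subset Set.sdiff_subset
  obtain ⟨n, hn⟩ := hfin.exists_encard_eq_coe
  rw [hn] at this ⊢
  norm_cast at this ⊢
  omega

/-- The truncated box and its boundary lie in the box enlarged by one on every side, less the first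
`j` points `R` of its side `y + x = -1`. The `j` points lost inside and outside cancel, and the
enlarged box has `α + β + 4` more points than the original. -/
theorem encard_vertexBoundary_truncatedBox_le {α β j : ℕ} (hj : 2 * j ≤ α + 2) :
    (vertexBoundary latticeGraph (truncatedBox α β j)).encard ≤ (α + β + 4 : ℕ) := by
  set R := (fun i : ℕ => ((-i : ℤ), (i : ℤ) + (-1))) '' (Finset.range j : Set ℕ) with hR
  set X := shiftedBox (-1) (-1) (α + 2) (β + 2) with hX
  have hXcard : X.encard = (((α + 3) * (β + 3) + 1) / 2 : ℕ) := by
    have h := (shiftedBox_congruentSets_translation (-1) (-1) (α + 2) (β + 2)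
      (by norm_num)).encard_eq
    have h2 := encard_latticeBox (α + 2) (β + 2)
    rw [latticeBox_eq_shiftedBox] at h2
    push_cast at h2
    rw [hX, h, h2]
  have hRX : R ⊆ X := by
    rintro _ ⟨i, hi, rfl⟩
    rw [Finset.mem_coe, Finset.mem_range] at hi
    change _ ∧ _ ∧ _ ∧ _
    dsimp only
    omega
  have hsub : truncatedBox α β j ∪ vertexBoundary latticeGraph (truncatedBox α β j) ⊆ X \ R := by
    rintro ⟨x, y⟩ (⟨⟨h1, h2, h3, h4⟩, h5⟩ | ⟨-, ⟨x', y'⟩, ⟨⟨h1, h2, h3, h4⟩, h5⟩, hadj⟩)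
    · simp only [Set.mem_ofPred_eq] at h1 h2 h3 h4 h5
      refine ⟨⟨by dsimp only; omega, by dsimp only; omega, by dsimp only; omega,
        by dsimp only; omega⟩, ?_⟩
      rintro ⟨i, hi, h⟩
      rw [Finset.mem_coe, Finset.mem_range] at hi
      simp only [Prod.mk.injEq] at h
      omega
    · rw [latticeGraph_adj_iff] at hadj
      simp only [Set.mem_ofPred_eq] at h1 h2 h3 h4 h5
      refine ⟨⟨by dsimp only; omega, by dsimp only; omega, by dsimp only; omega,
        by dsimp only; omega⟩, ?_⟩
      rintro ⟨i, hi, h⟩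
      rw [Finset.mem_coe, Finset.mem_range] at hi
      simp only [Prod.mk.injEq] at h
      omega
  have hdisj : Disjoint (truncatedBox α β j)
      (vertexBoundary latticeGraph (truncatedBox α β j)) :=
    Set.disjoint_left.2 fun p hp h => h.1 hp
  have hle := Set.encard_le_encard hsub
  rw [Set.encard_union_eq hdisj, encard_truncatedBox hj] at hle
  have hXR := Set.encard_sdiff_add_encard_of_subset hRX
  rw [hR, encard_removed, ← hR, hXcard] at hXR
  have hXfin : X.Finite := Set.finite_of_encard_eq_coe hXcard
  obtain ⟨n, hn⟩ := (hXfin.subset (Set.sdiff_subset (t := R))).exists_encard_eq_coe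
  obtain ⟨m, hm⟩ := (hXfin.subset ((Set.subset_union_right.trans hsub).trans
    Set.sdiff_subset)).exists_encard_eq_coe
  rw [hn] at hXR hle
  rw [hm] at hle ⊢
  norm_cast at hXR hle ⊢
  have e : (α + 3) * (β + 3) = (α + 1) * (β + 1) + 2 * (α + β + 4) := by ring
  have e2 : (α + 1) * (β + 1) = α * β + α + β + 1 := by ring
  have := Nat.zero_le (α * β)
  omega

/-! ### Minimal sets -/

/-- A boundary of at most `s + 3` vertices would give `8k ≤ (s + 1)² + 4` by the isoperimetric
inequality. -/
theorem isMinimalSet_of_encard_vertexBoundary_le {E : Set (ℤ × ℤ)} {k s : ℕ} (hk : E.encard = k)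
    (hE : (vertexBoundary latticeGraph E).encard ≤ (s + 4 : ℕ)) (hs : (s + 1) ^ 2 + 4 < 8 * k) :
    IsMinimalSet latticeGraph E := by
  intro B hB
  by_contra! hlt
  obtain ⟨m, hm⟩ := ENat.ne_top_iff_exists.1 hlt.ne_top
  obtain ⟨h4, h⟩ := eight_mul_card_le (hB.trans hk) (by nlinarith) hm.symm
  have hms : m < s + 4 := by
    have := hlt.trans_le hE
    rw [← hm] at this
    exact_mod_cast this
  have h2 := pow_le_pow_left₀ (n := 2) (by omega : (0 : ℤ) ≤ m - 2)
    (by omega : (m : ℤ) - 2 ≤ s + 1)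
  zify at hs
  omega

theorem truncatedBox_zero (α β : ℕ) : truncatedBox α β 0 = latticeBox α β := by
  refine sdiff_eq_left.2 (Set.disjoint_left.2 fun p hp h => ?_)
  obtain ⟨h1, h2, h3, h4⟩ := hp
  obtain ⟨h5, h6⟩ := h
  push_cast at h6
  omega

theorem encard_vertexBoundary_latticeBox_le (α β : ℕ) :
    (vertexBoundary latticeGraph (latticeBox α β)).encard ≤ (α + β + 4 : ℕ) := by
  rw [← truncatedBox_zero]
  exact encard_vertexBoundary_truncatedBox_le (by omega)

theorem encard_latticeBox_even (n : ℕ) :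
    (latticeBox (2 * n) (2 * n)).encard = (2 * n ^ 2 + 2 * n + 1 : ℕ) := by
  rw [encard_latticeBox, Nat.cast_inj]
  have : (2 * n + 1) * (2 * n + 1) = 2 * (2 * n ^ 2 + 2 * n) + 1 := by ring
  omega

theorem exists_encard_latticeBox_succ (n : ℕ) :
    ∃ k : ℕ, (latticeBox n (n + 1)).encard = k ∧ 8 * k = (2 * n + 3) ^ 2 - 1 := by
  refine ⟨_, encard_latticeBox _ _, ?_⟩
  obtain ⟨c, hc⟩ : 2 ∣ (n + 1) * (n + 1 + 1) := (Nat.even_mul_succ_self (n + 1)).two_dvd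
  have : (2 * n + 3) ^ 2 = 4 * ((n + 1) * (n + 1 + 1)) + 1 := by ring
  omega

theorem isMinimalSet_latticeBox_even (n : ℕ) :
    IsMinimalSet latticeGraph (latticeBox (2 * n) (2 * n)) := by
  refine isMinimalSet_of_encard_vertexBoundary_le (encard_latticeBox_even n)
    (encard_vertexBoundary_latticeBox_le _ _) ?_
  nlinarith

theorem isMinimalSet_latticeBox_succ {n : ℕ} (hn : 1 ≤ n) :
    IsMinimalSet latticeGraph (latticeBox n (n + 1)) := by
  obtain ⟨k, hk, hk8⟩ := exists_encard_latticeBox_succ n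
  refine isMinimalSet_of_encard_vertexBoundary_le hk (encard_vertexBoundary_latticeBox_le _ _) ?_
  rw [hk8]
  apply lt_tsub_iff_right.2
  nlinarith

theorem latticeBox_zero_one : latticeBox 0 1 = latticeBox 0 0 := by
  ext p
  change (_ ∧ _ ∧ _ ∧ _) ↔ (_ ∧ _ ∧ _ ∧ _)
  push_cast
  omega

theorem latticeBox_zero_zero : latticeBox 0 0 = {(0, 0)} := by
  ext ⟨x, y⟩
  rw [Set.mem_singleton_iff, Prod.mk.injEq]
  change (_ ∧ _ ∧ _ ∧ _) ↔ _
  dsimp only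
  push_cast
  omega

theorem isUniquelyMinimal_latticeBox_zero :
    IsUniquelyMinimal latticeGraph (latticeBox 0 0) := by
  refine ⟨isMinimalSet_latticeBox_even 0, fun B _ hcard => ?_⟩
  rw [latticeBox_zero_zero] at hcard ⊢
  rw [Set.encard_singleton, Set.encard_eq_one] at hcard
  obtain ⟨p, rfl⟩ := hcard
  exact ⟨translationIso (-p.1) (-p.2), by simp [translationIso]⟩

theorem IsMinimalSet.exists_encard_vertexBoundary {A E : Set (ℤ × ℤ)} {s : ℕ}
    (hA : IsMinimalSet latticeGraph A) (hcard : E.encard = A.encard)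
    (hE : (vertexBoundary latticeGraph E).encard ≤ (s : ℕ)) :
    ∃ t : ℕ, (vertexBoundary latticeGraph A).encard = t ∧ t ≤ s := by
  have h := (hA E hcard).trans hE
  obtain ⟨t, ht⟩ := ENat.ne_top_iff_exists.1 (ne_top_of_le_ne_top (ENat.natCast_ne_top s) h)
  rw [← ht] at h
  exact ⟨t, ht.symm, by exact_mod_cast h⟩

theorem isUniquelyMinimal_latticeBox_even (n : ℕ) :
    IsUniquelyMinimal latticeGraph (latticeBox (2 * n) (2 * n)) := by
  rcases Nat.eq_zero_or_pos n with rfl | hn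
  · exact isUniquelyMinimal_latticeBox_zero
  refine ⟨isMinimalSet_latticeBox_even n, fun B hB hcard => ?_⟩
  obtain ⟨t, ht, hle⟩ := hB.exists_encard_vertexBoundary hcard.symm
    (encard_vertexBoundary_latticeBox_le _ _)
  rw [encard_latticeBox_even] at hcard
  obtain ⟨h4, h8⟩ := eight_mul_card_le hcard (by omega) ht
  have e : 8 * ((2 * n ^ 2 + 2 * n + 1 : ℕ) : ℤ) = (4 * n + 2) ^ 2 + 4 := by push_cast; ring
  have htn : (t : ℤ) - 2 = 4 * n + 2 := by
    have := abs_le_of_sq_le_sq' (by omega : ((4 * n + 2 : ℤ)) ^ 2 ≤ ((t : ℤ) - 2) ^ 2) (by omega)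
    omega
  rw [← htn] at e
  obtain ⟨u, v, α, β, hbox, hsum, heven, -⟩ :=
    eq_shiftedBox_of_extremal hcard (by nlinarith) ht (Or.inl e)
  obtain ⟨rfl, hpar⟩ := heven e
  obtain rfl : α = 2 * n := by omega
  rw [hbox, latticeBox_eq_shiftedBox]
  push_cast
  exact shiftedBox_congruentSets_translation _ _ _ _ hpar

theorem isUniquelyMinimal_latticeBox_succ (n : ℕ) :
    IsUniquelyMinimal latticeGraph (latticeBox n (n + 1)) := by
  -- For `n = 0` the box degenerates to a point, whose boundary has 4 vertices rather than `α + β +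
  -- 4 = 5`.
  rcases Nat.eq_zero_or_pos n with rfl | hn
  · rw [latticeBox_zero_one]
    exact isUniquelyMinimal_latticeBox_zero
  refine ⟨isMinimalSet_latticeBox_succ hn, fun B hB hcard => ?_⟩
  obtain ⟨t, ht, hle⟩ := hB.exists_encard_vertexBoundary hcard.symm
    (encard_vertexBoundary_latticeBox_le _ _)
  obtain ⟨k, hk, hk8⟩ := exists_encard_latticeBox_succ n
  have e : 8 * (k : ℤ) = (2 * n + 3) ^ 2 - 1 := by
    have : 1 ≤ (2 * n + 3) ^ 2 := Nat.one_le_pow _ _ (by omega)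
    zify [this] at hk8
    exact hk8
  have hk2 : 2 ≤ k := by nlinarith
  rw [hk] at hcard
  obtain ⟨h4, h8⟩ := eight_mul_card_le hcard (by omega) ht
  have htn : (t : ℤ) - 2 = 2 * n + 3 := by
    by_contra hne
    have := pow_le_pow_left₀ (n := 2) (by omega : (0 : ℤ) ≤ t - 2)
      (by omega : (t : ℤ) - 2 ≤ 2 * n + 2)
    nlinarith
  rw [← htn] at e
  obtain ⟨u, v, α, β, hbox, hsum, -, hodd⟩ :=
    eq_shiftedBox_of_extremal hcard hk2 ht (Or.inr e)
  rw [hbox, latticeBox_eq_shiftedBox]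
  push_cast
  rcases hodd e with h | h
  · obtain ⟨rfl, rfl⟩ : α = n + 1 ∧ β = n := by omega
    exact (shiftedBox_congruentSets_of_odd _ _ _ _ (by omega)).trans
      (shiftedBox_congruentSets_negFst _ _ _ _)
  · obtain ⟨rfl, rfl⟩ : β = n + 1 ∧ α = n := by omega
    exact shiftedBox_congruentSets_of_odd _ _ _ _ (by omega)

/-! ### Sizes without uniquely minimal sets -/

/-- The second set has diameter at least `β'`, the first at most `max α β`. The condition `2 * j' ≤
α'` keeps a point on the truncated side, and `hpar` provides one on the opposite side. -/
theorem not_congruentSets_truncatedBox {α β α' β' j j' : ℕ} (hα : α < β') (hβ : β < β')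
    (hj : 2 * j' ≤ α') (hpar : β' % 2 = 0 ∨ 1 ≤ α') :
    ¬ CongruentSets latticeGraph (truncatedBox α β j) (truncatedBox α' β' j') := by
  have hp : ((-j' : ℤ), (j' : ℤ)) ∈ truncatedBox α' β' j' := by
    refine ⟨⟨?_, ?_, ?_, ?_⟩, fun h => ?_⟩
    · dsimp only; omega
    · dsimp only; omega
    · dsimp only; omega
    · dsimp only; omega
    · have := h.2
      dsimp only at this
      omega
  have hq : (((β' / 2 : ℕ) : ℤ), (β' : ℤ) - (β' / 2 : ℕ)) ∈ truncatedBox α' β' j' := by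
    refine ⟨⟨?_, ?_, ?_, ?_⟩, fun h => ?_⟩
    · dsimp only; omega
    · dsimp only; omega
    · dsimp only; omega
    · dsimp only; omega
    · have := h.1
      dsimp only at this
      omega
  refine not_congruentSets_of_l1_lt hp hq ?_
  rintro ⟨x, y⟩ ⟨⟨h1, h2, h3, h4⟩, -⟩ ⟨z, w⟩ ⟨⟨h5, h6, h7, h8⟩, -⟩
  rw [l1_eq, l1_eq]
  dsimp only at *
  rw [show (j' : ℤ) + -j' - (β' - (β' / 2 : ℕ) + (β' / 2 : ℕ)) = -β' by ring, abs_neg]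
  refine lt_max_of_lt_right (max_lt ?_ ?_)
  · exact abs_lt.2 (by rw [Nat.abs_cast]; omega)
  · exact abs_lt.2 (by rw [Nat.abs_cast]; omega)

/-- A size attained by two truncated boxes of minimal boundary but different diameter does not
belong to a uniquely minimal set. -/
theorem not_isUniquelyMinimal_of_truncatedBox {A : Set (ℤ × ℤ)} {k α β α' β' j j' : ℕ}
    (hA : A.encard = k) (hα : α < β') (hβ : β < β') (hpar : β' % 2 = 0 ∨ 1 ≤ α')
    (hj : 2 * j ≤ α + 2) (hj' : 2 * j' ≤ α') (hsum : α + β = α' + β')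
    (hk : ((α + 1) * (β + 1) + 1) / 2 = k + j) (hk' : ((α' + 1) * (β' + 1) + 1) / 2 = k + j')
    (h8 : (α + β + 1) ^ 2 + 4 < 8 * k) : ¬ IsUniquelyMinimal latticeGraph A := by
  intro hU
  have e1 : (truncatedBox α β j).encard = k := by
    rw [encard_truncatedBox hj, hk, Nat.add_sub_cancel]
  have e2 : (truncatedBox α' β' j').encard = k := by
    rw [encard_truncatedBox (by omega), hk', Nat.add_sub_cancel]
  have m1 := isMinimalSet_of_encard_vertexBoundary_le e1
    (encard_vertexBoundary_truncatedBox_le hj) h8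
  have m2 := isMinimalSet_of_encard_vertexBoundary_le e2
    (encard_vertexBoundary_truncatedBox_le (by omega)) (hsum ▸ h8)
  exact not_congruentSets_truncatedBox hα hβ hj' hpar
    ((hU.2 _ m1 (e1.trans hA.symm)).trans (hU.2 _ m2 (e2.trans hA.symm)).symm)

theorem exists_congruentSets_latticeBox {A : Set (ℤ × ℤ)} (hfin : A.Finite) (hne : A.Nonempty)
    (hU : IsUniquelyMinimal latticeGraph A) :
    ∃ n : ℕ, CongruentSets latticeGraph A (latticeBox (2 * n) (2 * n)) ∨
      CongruentSets latticeGraph A (latticeBox n (n + 1)) := by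
  obtain ⟨k, hk⟩ := hfin.exists_encard_eq_coe
  have hk1 : 1 ≤ k := by
    have := Set.one_le_encard_iff_nonempty.2 hne
    rw [hk] at this
    exact_mod_cast this
  have hex : ∃ s : ℕ, 8 * k ≤ (s + 2) ^ 2 + 4 := ⟨8 * k, by nlinarith⟩
  -- The least such `s`: every set of `k` points has at least `s + 4` boundary vertices, and boxes
  -- with side sum `s` serve as candidates for equality.
  obtain ⟨s, hs, hmin⟩ : ∃ s : ℕ, 8 * k ≤ (s + 2) ^ 2 + 4 ∧ (s + 1) ^ 2 + 4 < 8 * k := by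
    refine ⟨Nat.find hex, Nat.find_spec hex, ?_⟩
    rcases h : Nat.find hex with _ | m
    · omega
    · have := Nat.find_min hex (m := m) (by omega)
      rw [show m + 1 + 1 = m + 2 from rfl]
      omega
  have even : ∀ n : ℕ, 8 * k = (4 * n + 2) ^ 2 + 4 →
      CongruentSets latticeGraph A (latticeBox (2 * n) (2 * n)) := fun n h =>
    (hU.2 _ (isMinimalSet_latticeBox_even n) (by
      rw [encard_latticeBox_even, hk, Nat.cast_inj]
      have : (4 * n + 2) ^ 2 + 4 = 8 * (2 * n ^ 2 + 2 * n + 1) := by ring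
      omega)).symm
  obtain ⟨n, hn | hn | hn⟩ : ∃ n, s = 4 * n ∨ s = 4 * n + 2 ∨ s = 2 * n + 1 := by
    rcases (by omega : s % 4 = 0 ∨ s % 4 = 2 ∨ s % 2 = 1) with h | h | h
    · exact ⟨s / 4, by omega⟩
    · exact ⟨s / 4, by omega⟩
    · exact ⟨s / 2, by omega⟩
  · subst hn
    by_cases he : 8 * k = (4 * n + 2) ^ 2 + 4
    · exact ⟨n, Or.inl (even n he)⟩
    · exfalso
      obtain ⟨w, hw⟩ : ∃ w, w = n ^ 2 := ⟨_, rfl⟩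
      have f1 : (4 * n + 2) ^ 2 = 16 * w + 16 * n + 4 := by rw [hw]; ring
      have f2 : (4 * n + 1) ^ 2 = 16 * w + 8 * n + 1 := by rw [hw]; ring
      have f3 : (2 * n + 1) * (2 * n + 1) = 4 * w + 4 * n + 1 := by rw [hw]; ring
      have hn1 : 1 ≤ n := by
        rcases Nat.eq_zero_or_pos n with rfl | h
        · simp at hw
          omega
        · exact h
      have f4 : (2 * n - 1 + 1) * (2 * n + 1 + 1) = 4 * w + 4 * n := by
        rw [hw, Nat.sub_add_cancel (by omega)]; ring
      -- `B(2n - 1, 2n + 1)` has one point fewer than `B(2n, 2n)`, so both have room once `k` is not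
      -- the size of the latter.
      refine not_isUniquelyMinimal_of_truncatedBox (k := k) (α := 2 * n) (β := 2 * n)
        (α' := 2 * n - 1) (β' := 2 * n + 1) (j := 2 * w + 2 * n + 1 - k)
        (j' := 2 * w + 2 * n - k) hk (by omega) (by omega) (by omega) (by omega) (by omega)
        (by omega) (by omega) (by omega) ?_ hU
      rw [show 2 * n + 2 * n + 1 = 4 * n + 1 by ring]
      exact hmin
  · subst hn
    exfalso
    obtain ⟨w, hw⟩ : ∃ w, w = n ^ 2 := ⟨_, rfl⟩
    have f1 : (4 * n + 2 + 2) ^ 2 = 16 * w + 32 * n + 16 := by rw [hw]; ring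
    have f2 : (4 * n + 2 + 1) ^ 2 = 16 * w + 24 * n + 9 := by rw [hw]; ring
    have f3 : (2 * n + 1 + 1) * (2 * n + 1 + 1) = 4 * w + 8 * n + 4 := by rw [hw]; ring
    have f4 : (2 * n + 1) * (2 * n + 2 + 1) = 4 * w + 8 * n + 3 := by rw [hw]; ring
    -- `B(2n + 1, 2n + 1)` and `B(2n, 2n + 2)` have the same size `2(n + 1)²`, the largest possible
    -- for this `s`, so no size is exceptional.
    refine not_isUniquelyMinimal_of_truncatedBox (k := k) (α := 2 * n + 1) (β := 2 * n + 1)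
      (α' := 2 * n) (β' := 2 * n + 2) (j := 2 * w + 4 * n + 2 - k)
      (j' := 2 * w + 4 * n + 2 - k) hk (by omega) (by omega) (by omega) (by omega) (by omega)
      (by omega) (by omega) (by omega) ?_ hU
    rw [show 2 * n + 1 + (2 * n + 1) + 1 = 4 * n + 2 + 1 by ring]
    exact hmin
  · subst hn
    obtain ⟨w, hw⟩ : ∃ w, w = n ^ 2 := ⟨_, rfl⟩
    have f1 : (2 * n + 1 + 2) ^ 2 = 4 * w + 12 * n + 9 := by rw [hw]; ring
    have f2 : (2 * n + 1 + 1) ^ 2 = 4 * w + 8 * n + 4 := by rw [hw]; ring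
    have hn0 : n = 0 → w = 0 := by rintro rfl; simpa using hw
    have hn1 : 1 ≤ n := by omega
    obtain ⟨k', hk', hk8⟩ := exists_encard_latticeBox_succ n
    have f5 : (2 * n + 3) ^ 2 = 4 * w + 12 * n + 9 := by rw [hw]; ring
    by_cases he : k = k'
    · exact ⟨n, Or.inr (hU.2 _ (isMinimalSet_latticeBox_succ hn1) (by
        rw [hk', hk, he])).symm⟩
    · exfalso
      have f3 : (n + 1) * (n + 1 + 1) = w + 3 * n + 2 := by rw [hw]; ring
      have f4 : (n - 1 + 1) * (n + 2 + 1) = w + 3 * n := by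
        rw [hw, Nat.sub_add_cancel hn1]; ring
      -- `B(n - 1, n + 2)` has `k' - 1` points, one fewer than `B(n, n + 1)`; again only the top
      -- size `k'` escapes.
      refine not_isUniquelyMinimal_of_truncatedBox (k := k) (α := n) (β := n + 1)
        (α' := n - 1) (β' := n + 2) (j := k' - k)
        (j' := k' - 1 - k) hk (by omega) (by omega) (by omega) (by omega) (by omega)
        (by omega) (by omega) (by omega) ?_ hU
      rw [show n + (n + 1) + 1 = 2 * n + 1 + 1 by ring]
      exact hmin

theorem theoremB (A : Set (ℤ × ℤ)) (hfin : A.Finite) (hne : A.Nonempty) :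
    IsUniquelyMinimal latticeGraph A ↔
      ∃ n : ℕ, CongruentSets latticeGraph A (latticeBox (2 * n) (2 * n)) ∨
        CongruentSets latticeGraph A (latticeBox n (n + 1)) := by
  refine ⟨exists_congruentSets_latticeBox hfin hne, ?_⟩
  rintro ⟨n, h | h⟩
  · exact h.isUniquelyMinimal (isUniquelyMinimal_latticeBox_even n)
  · exact h.isUniquelyMinimal (isUniquelyMinimal_latticeBox_succ n)
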